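/- Let $A$ be an entrywise non-negative real $d\times d$ matrix with spectral radius $\rho(A)>1$, let $\|\cdot\|$ be the Frobenius norm on matrices, and consider the positive stabilization problem $$\|X-A\|\to\min,\qquad X\ge 0 \ \text{(entrywise)},\quad \rho(X)\le 1 .$$ If an entrywise strictly positive matrix $X$ is a local minimum of this problem, then it is a global minimum. Moreover, in this case let $M=(I-A^T)(I-A)$ and let $\mu$ be the smallest eigenvalue of $M$. Then $\mu>0$, and there is an eigenvector $v$ of $M$ for the eigenvalue $\mu$, with strictly positive entries and $v^Tv=1$, such that $$X \;=\; A-(A-I)\,v\,v^T .$$ With $r=-\sqrt{\mu}$ and $u=\frac1r (I-A)v$, the vector $u$ and the matrix $A+r\,u\,v^T$ are entrywise non-negative, and $X=A+r\,u\,v^T$. -/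

import Mathlib

open Matrix

-- `‖X‖` on matrices is the Frobenius norm `√(∑ i j, |x i j| ^ 2)`.
attribute [local instance] Matrix.frobeniusNormedAddCommGroup

namespace ClosestStable

/-- The spectral radius `ρ(X)` of a real square matrix: the largest modulus of its complex
eigenvalues (so that non-real eigenvalues are counted). -/
noncomputable def rho {d : ℕ} (X : Matrix (Fin d) (Fin d) ℝ) : ENNReal :=
  spectralRadius ℂ (X.map (algebraMap ℝ ℂ))

/-- The feasible set of the positive stabilization problem: `X ≥ 0` entrywise, `ρ(X) ≤ 1`. -/
def stableNonneg (d : ℕ) : Set (Matrix (Fin d) (Fin d) ℝ) :=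
  {X | (∀ i j, 0 ≤ X i j) ∧ rho X ≤ 1}

/-- The matrix `M = (I - Aᵀ)(I - A)`. -/
def matM {d : ℕ} (A : Matrix (Fin d) (Fin d) ℝ) : Matrix (Fin d) (Fin d) ℝ :=
  (1 - Aᵀ) * (1 - A)

/-- `μ` is the smallest eigenvalue of the symmetric real matrix `S`
(all of whose eigenvalues are real). -/
def IsSmallestEigenvalue {d : ℕ} (S : Matrix (Fin d) (Fin d) ℝ) (μ : ℝ) : Prop :=
  IsLeast {t : ℝ | Module.End.HasEigenvalue (Matrix.toLin' S) t} μ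

/-- The vector `u = (1/r) (I - A) v`. -/
noncomputable def vecU {d : ℕ} (A : Matrix (Fin d) (Fin d) ℝ) (r : ℝ) (v : Fin d → ℝ) :
    Fin d → ℝ :=
  (1 / r) • ((1 - A) *ᵥ v)

/-- The matrix `A + r u vᵀ` with `u = (1/r) (I - A) v`. -/
noncomputable def matX {d : ℕ} (A : Matrix (Fin d) (Fin d) ℝ) (r : ℝ) (v : Fin d → ℝ) :
    Matrix (Fin d) (Fin d) ℝ :=
  A + r • vecMulVec (vecU A r v) v

/-- The hypotheses of the explicit formula for the closest stable matrix, for the data `μ`, `v`: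
`μ ≠ 0` is the smallest eigenvalue of `M`, `v` is a non-negative eigenvector of `M` for `μ` of
Euclidean norm one, and with `r = -√μ` both `u` and `A + r u vᵀ` are non-negative. -/
structure FormulaHypotheses {d : ℕ} (A : Matrix (Fin d) (Fin d) ℝ) (μ : ℝ) (v : Fin d → ℝ) :
    Prop where
  ne_zero : μ ≠ 0
  smallest : IsSmallestEigenvalue (matM A) μ
  eigenvector : Module.End.HasEigenvector (Matrix.toLin' (matM A)) μ v
  unit : v ⬝ᵥ v = 1
  v_nonneg : ∀ i, 0 ≤ v i
  u_nonneg : ∀ i, 0 ≤ vecU A (-√μ) v i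
  x_nonneg : ∀ i j, 0 ≤ matX A (-√μ) v i j

end ClosestStable

namespace ClosestStable

/-! Positivity of `X` leaves every small perturbation non-negative, so feasibility only requires a
positive vector to stay superharmonic. Perturbing single rows against the right Perron vector, and
single columns against the left one, forces `A = X + b vᵀ` with `X v = v` and `bᵀ X = bᵀ`
(`exists_eq_add_vecMulVec`). Hence `(A - 1) v = b` and `bᵀ (A - 1) = |b|² vᵀ`, so `|b|` is a
singular value of `A - 1`.

It is the smallest one: moving `v` to a nearby `x` and passing to the matrix nearest to `A` that
fixes `x` turns local minimality of `X` into local minimality of the Rayleigh quotient `|(A - 1) x|²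
/ |x|²`, which is global for a quadratic form (`mul_dotProduct_le_of_isLocalMinOn`).

Conversely, if a feasible `Y` were closer to `A` than this singular value, no matrix on the segment
from `Y` to `A` would have eigenvalue 1. Strictly superharmonic vectors then persist along the
segment (`exists_superharmonic_of_path`), contradicting `ρ(A) > 1` (`le_norm_sub_sq`). -/

variable {d : ℕ}

/-! ### Positive vectors as certificates for the spectral radius -/

/-- A complex eigenvalue of a non-negative matrix yields a non-negative subeigenvector. -/
theorem exists_nonneg_subeigenvector {Y : Matrix (Fin d) (Fin d) ℝ} (hY : ∀ i j, 0 ≤ Y i j)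
    {k : ℂ} (hk : k ∈ spectrum ℂ (Y.map (algebraMap ℝ ℂ))) :
    ∃ z : Fin d → ℝ, (∀ i, 0 ≤ z i) ∧ (∃ i, 0 < z i) ∧ ∀ i, ‖k‖ * z i ≤ (Y *ᵥ z) i := by
  rw [spectrum.mem_iff, Matrix.isUnit_iff_isUnit_det, isUnit_iff_ne_zero, not_not,
    ← Matrix.exists_mulVec_eq_zero_iff] at hk
  obtain ⟨x, hx0, hx⟩ := hk
  obtain ⟨i₀, hi₀⟩ := Function.ne_iff.mp hx0
  refine ⟨fun i => ‖x i‖, fun i => norm_nonneg _, ⟨i₀, norm_pos_iff.mpr hi₀⟩, fun i => ?_⟩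
  have h1 : k * x i = ∑ j, (Y i j : ℂ) * x j := by
    have := congrFun hx i
    rw [Matrix.sub_mulVec, Algebra.algebraMap_eq_smul_one, Matrix.smul_mulVec,
      Matrix.one_mulVec] at this
    simpa [sub_eq_zero, Matrix.mulVec, dotProduct] using this
  rw [← norm_mul, h1]
  refine (norm_sum_le _ _).trans (le_of_eq ?_)
  simp only [Matrix.mulVec, dotProduct]
  refine Finset.sum_congr rfl fun j _ => ?_
  rw [norm_mul, Complex.norm_real, Real.norm_of_nonneg (hY i j)]

theorem rho_le_one_of_forall {Y : Matrix (Fin d) (Fin d) ℝ}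
    (h : ∀ k ∈ spectrum ℂ (Y.map (algebraMap ℝ ℂ)), ‖k‖ ≤ 1) : rho Y ≤ 1 := by
  refine iSup₂_le fun k hk => ?_
  have := h k hk
  exact_mod_cast this

/-- A non-negative matrix with a positive superharmonic column vector is feasible. -/
theorem mem_stableNonneg_of_mulVec_le {Y : Matrix (Fin d) (Fin d) ℝ} (hY : ∀ i j, 0 ≤ Y i j)
    {w : Fin d → ℝ} (hw : ∀ i, 0 < w i) (h : ∀ i, (Y *ᵥ w) i ≤ w i) : Y ∈ stableNonneg d := by
  refine ⟨hY, rho_le_one_of_forall fun k hk => ?_⟩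
  obtain ⟨z, hz, ⟨i₀, hi₀⟩, hkz⟩ := exists_nonneg_subeigenvector hY hk
  have : Nonempty (Fin d) := ⟨i₀⟩
  -- The largest ratio `c` gives `z ≤ c w` with equality at `i`; the two inequalities are compared
  -- there.
  obtain ⟨i, hi⟩ := Finite.exists_max fun i => z i / w i
  set c := z i / w i with hc
  have hcpos : 0 < c := (div_pos hi₀ (hw i₀)).trans_le (hi i₀)
  have hzc : ∀ j, z j ≤ c * w j := fun j => (div_le_iff₀ (hw j)).mp (hi j)
  have hzi : z i = c * w i := by rw [hc, div_mul_cancel₀ _ (hw i).ne']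
  have h1 : (Y *ᵥ z) i ≤ c * (Y *ᵥ w) i := by
    simp only [Matrix.mulVec, dotProduct, Finset.mul_sum]
    refine Finset.sum_le_sum fun j _ => ?_
    nlinarith [mul_le_mul_of_nonneg_left (hzc j) (hY i j)]
  have h2 : ‖k‖ * (c * w i) ≤ 1 * (c * w i) := by
    rw [← hzi, one_mul]
    refine (hkz i).trans (h1.trans ?_)
    rw [hzi]
    exact mul_le_mul_of_nonneg_left (h i) hcpos.le
  exact le_of_mul_le_mul_right h2 (mul_pos hcpos (hw i))

/-- A non-negative matrix with a positive superharmonic row vector is feasible. -/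
theorem mem_stableNonneg_of_vecMul_le {Y : Matrix (Fin d) (Fin d) ℝ} (hY : ∀ i j, 0 ≤ Y i j)
    {y : Fin d → ℝ} (hy : ∀ i, 0 < y i) (h : ∀ i, (y ᵥ* Y) i ≤ y i) : Y ∈ stableNonneg d := by
  refine ⟨hY, rho_le_one_of_forall fun k hk => ?_⟩
  obtain ⟨z, hz, ⟨i₀, hi₀⟩, hkz⟩ := exists_nonneg_subeigenvector hY hk
  have hpos : 0 < y ⬝ᵥ z :=
    Finset.sum_pos' (fun i _ => mul_nonneg (hy i).le (hz i))
      ⟨i₀, Finset.mem_univ _, mul_pos (hy i₀) hi₀⟩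
  have h1 : ‖k‖ * (y ⬝ᵥ z) ≤ y ⬝ᵥ (Y *ᵥ z) := by
    simp only [dotProduct, Finset.mul_sum]
    refine Finset.sum_le_sum fun i _ => ?_
    nlinarith [mul_le_mul_of_nonneg_left (hkz i) (hy i).le]
  have h2 : y ⬝ᵥ (Y *ᵥ z) ≤ y ⬝ᵥ z := by
    rw [Matrix.dotProduct_mulVec]
    exact Finset.sum_le_sum fun i _ => mul_le_mul_of_nonneg_right (h i) (hz i)
  exact le_of_mul_le_mul_right (by linarith) hpos

/-- A real eigenvalue is bounded by the spectral radius. -/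
theorem abs_le_one_of_mulVec_eq {Y : Matrix (Fin d) (Fin d) ℝ} (hY : rho Y ≤ 1)
    {w : Fin d → ℝ} (hw : w ≠ 0) {l : ℝ} (h : Y *ᵥ w = l • w) : |l| ≤ 1 := by
  have hk : (l : ℂ) ∈ spectrum ℂ (Y.map (algebraMap ℝ ℂ)) := by
    rw [spectrum.mem_iff, Matrix.isUnit_iff_isUnit_det, isUnit_iff_ne_zero, not_not,
      ← Matrix.exists_mulVec_eq_zero_iff]
    refine ⟨fun i => (w i : ℂ), fun h0 => hw ?_, ?_⟩
    · ext i
      simpa using congrFun h0 i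
    · ext i
      rw [Matrix.sub_mulVec, Algebra.algebraMap_eq_smul_one, Matrix.smul_mulVec,
        Matrix.one_mulVec]
      have := congrFun h i
      simp only [Matrix.mulVec, dotProduct, Pi.smul_apply, smul_eq_mul] at this
      simp only [Matrix.mulVec, dotProduct, Pi.smul_apply, smul_eq_mul, Pi.sub_apply,
        Matrix.map_apply, Complex.coe_algebraMap, Pi.zero_apply, sub_eq_zero]
      exact_mod_cast this.symm
  have h1 : ((‖(l : ℂ)‖₊ : NNReal) : ENNReal) ≤ 1 := (le_iSup₂ (f := fun (k : ℂ)
    (_ : k ∈ spectrum ℂ (Y.map (algebraMap ℝ ℂ))) => ((‖k‖₊ : NNReal) : ENNReal)) _ hk).trans hY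
  have h2 : ‖(l : ℂ)‖₊ ≤ 1 := by exact_mod_cast h1
  have h3 : ‖(l : ℂ)‖ ≤ 1 := h2
  simpa using h3

/-! ### Perron eigenvectors -/

theorem mulVec_nonneg {Z : Matrix (Fin d) (Fin d) ℝ} (hZ : ∀ i j, 0 ≤ Z i j) {x : Fin d → ℝ}
    (hx : ∀ i, 0 ≤ x i) (i : Fin d) : 0 ≤ (Z *ᵥ x) i := by
  simp only [Matrix.mulVec, dotProduct]
  exact Finset.sum_nonneg fun j _ => mul_nonneg (hZ i j) (hx j)

theorem mulVec_pos {X : Matrix (Fin d) (Fin d) ℝ} (hX : ∀ i j, 0 < X i j) {z : Fin d → ℝ}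
    (hz : ∀ i, 0 ≤ z i) (hz0 : z ≠ 0) (i : Fin d) : 0 < (X *ᵥ z) i := by
  obtain ⟨j, hj⟩ := Function.ne_iff.mp hz0
  exact Finset.sum_pos' (fun k _ => mul_nonneg (hX i k).le (hz k))
    ⟨j, Finset.mem_univ _, mul_pos (hX i j) ((hz j).lt_of_ne' hj)⟩

/-- Perron's theorem: a positive matrix has a positive eigenvector. -/
theorem exists_pos_eigenvector (hd : 0 < d) {X : Matrix (Fin d) (Fin d) ℝ}
    (hX : ∀ i j, 0 < X i j) :
    ∃ (l : ℝ) (w : Fin d → ℝ), (∀ i, 0 < w i) ∧ X *ᵥ w = l • w := by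
  -- Collatz–Wielandt: `l` is maximized over pairs with `l z ≤ X z`. The cap on `l` follows from
  -- that inequality and only serves compactness.
  let K : Set (ℝ × (Fin d → ℝ)) :=
    (Set.Icc 0 (∑ i, ∑ j, X i j) ×ˢ stdSimplex ℝ (Fin d)) ∩
      {p | ∀ i, p.1 * p.2 i ≤ (X *ᵥ p.2) i}
  have hKc : IsCompact K := by
    refine (isCompact_Icc.prod (isCompact_stdSimplex ℝ (Fin d))).inter_right ?_
    rw [Set.ofPred_forall]
    refine isClosed_iInter fun i => isClosed_le (by fun_prop) ?_
    simp only [Matrix.mulVec, dotProduct]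
    fun_prop
  have hbound : ∀ l : ℝ, ∀ z ∈ stdSimplex ℝ (Fin d), (∀ i, l * z i ≤ (X *ᵥ z) i) →
      l ≤ ∑ i, ∑ j, X i j := by
    intro l z hz h
    calc l = ∑ i, l * z i := by rw [← Finset.mul_sum, hz.2, mul_one]
      _ ≤ ∑ i, (X *ᵥ z) i := Finset.sum_le_sum fun i _ => h i
      _ ≤ _ := by
        simp only [Matrix.mulVec, dotProduct]
        refine Finset.sum_le_sum fun i _ => Finset.sum_le_sum fun j _ => ?_
        have : z j ≤ 1 := hz.2 ▸ Finset.single_le_sum (fun k _ => hz.1 k) (Finset.mem_univ j)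
        exact mul_le_of_le_one_right (hX i j).le this
  have hKn : K.Nonempty := by
    have hz := single_mem_stdSimplex ℝ (⟨0, hd⟩ : Fin d)
    have h0 : ∀ i, (0 : ℝ) * (Pi.single (⟨0, hd⟩ : Fin d) (1 : ℝ) : Fin d → ℝ) i ≤
        (X *ᵥ Pi.single (⟨0, hd⟩ : Fin d) (1 : ℝ)) i := fun i => by
      rw [zero_mul]
      exact mulVec_nonneg (fun i j => (hX i j).le) hz.1 i
    exact ⟨(0, Pi.single ⟨0, hd⟩ 1), ⟨⟨⟨le_rfl, hbound 0 _ hz h0⟩, hz⟩, h0⟩⟩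
  obtain ⟨⟨l, w⟩, ⟨⟨hl, hw⟩, hlw⟩, hmax⟩ := hKc.exists_isMaxOn hKn continuous_fst.continuousOn
  simp only [Set.mem_ofPred_eq] at hl hw hlw
  have hw0 : w ≠ 0 := by
    rintro rfl
    simpa using hw.2
  have hw' := mulVec_pos hX hw.1 hw0
  have heq : X *ᵥ w = l • w := by
    by_contra hne
    -- A nonzero defect `h ≥ 0` gives `X h > 0`, so the normalized `X w` admits the larger value `l
    -- + e`.
    set h := X *ᵥ w - l • w with hh
    have hXh := mulVec_pos hX (z := h) (fun i => by simpa [hh] using hlw i) (sub_ne_zero.mpr hne)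
    have : Nonempty (Fin d) := ⟨⟨0, hd⟩⟩
    obtain ⟨i₀, hi₀⟩ := Finite.exists_min fun i => (X *ᵥ h) i / (X *ᵥ w) i
    set e := (X *ᵥ h) i₀ / (X *ᵥ w) i₀
    have he : 0 < e := div_pos (hXh i₀) (hw' i₀)
    have hle : ∀ i, (l + e) * (X *ᵥ w) i ≤ (X *ᵥ (X *ᵥ w)) i := by
      intro i
      have h1 : e * (X *ᵥ w) i ≤ (X *ᵥ h) i := (le_div_iff₀ (hw' i)).mp (hi₀ i)
      have h2 : (X *ᵥ h) i = (X *ᵥ (X *ᵥ w)) i - l * (X *ᵥ w) i := by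
        rw [hh, Matrix.mulVec_sub, Matrix.mulVec_smul]; rfl
      linarith
    have hs : 0 < ∑ i, (X *ᵥ w) i := Finset.sum_pos (fun i _ => hw' i) Finset.univ_nonempty
    have hmem : (∑ i, (X *ᵥ w) i)⁻¹ • (X *ᵥ w) ∈ stdSimplex ℝ (Fin d) := by
      refine ⟨fun i => mul_nonneg (inv_nonneg.mpr hs.le) (hw' i).le, ?_⟩
      simp only [Pi.smul_apply, smul_eq_mul, ← Finset.mul_sum]
      exact inv_mul_cancel₀ hs.ne'
    have hle' : ∀ i, (l + e) * ((∑ i, (X *ᵥ w) i)⁻¹ • (X *ᵥ w)) i ≤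
        (X *ᵥ ((∑ i, (X *ᵥ w) i)⁻¹ • (X *ᵥ w))) i := by
      intro i
      rw [Matrix.mulVec_smul, Pi.smul_apply, Pi.smul_apply, smul_eq_mul, smul_eq_mul]
      nlinarith [mul_le_mul_of_nonneg_left (hle i) (inv_nonneg.mpr hs.le)]
    have := hmax (show (l + e, (∑ i, (X *ᵥ w) i)⁻¹ • (X *ᵥ w)) ∈ K from
      ⟨⟨⟨by linarith [hl.1], hbound _ _ hmem hle'⟩, hmem⟩, hle'⟩)
    simp only [Set.mem_ofPred_eq] at this
    linarith
  refine ⟨l, w, fun i => ?_, heq⟩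
  have h1 := hw' i
  rw [heq] at h1
  exact pos_of_mul_pos_right h1 hl.1

/-- Right and left Perron eigenvectors of a positive matrix share their eigenvalue. -/
theorem exists_pos_eigenvector_pair (hd : 0 < d) {X : Matrix (Fin d) (Fin d) ℝ}
    (hX : ∀ i j, 0 < X i j) :
    ∃ (l : ℝ) (w y : Fin d → ℝ), (∀ i, 0 < w i) ∧ (∀ i, 0 < y i) ∧ X *ᵥ w = l • w ∧
      y ᵥ* X = l • y := by
  obtain ⟨l, w, hw, hlw⟩ := exists_pos_eigenvector hd hX
  obtain ⟨l', y, hy, hly⟩ := exists_pos_eigenvector hd (X := Xᵀ) fun i j => hX j i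
  rw [Matrix.mulVec_transpose] at hly
  have : Nonempty (Fin d) := ⟨⟨0, hd⟩⟩
  have hpos : 0 < y ⬝ᵥ w :=
    Finset.sum_pos (fun i _ => mul_pos (hy i) (hw i)) Finset.univ_nonempty
  have h1 := Matrix.dotProduct_mulVec y X w
  rw [hlw, hly, dotProduct_smul, smul_dotProduct, smul_eq_mul, smul_eq_mul] at h1
  have : l = l' := mul_right_cancel₀ hpos.ne' h1
  exact ⟨l, w, y, hw, hy, hlw, this ▸ hly⟩

/-! ### Superharmonic vectors along a path -/

/-- The minimum principle for a non-negative matrix with a strictly superharmonic vector. -/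
theorem nonneg_of_mulVec_le {Z : Matrix (Fin d) (Fin d) ℝ} (hZ : ∀ i j, 0 ≤ Z i j)
    {w x : Fin d → ℝ} (hw : ∀ i, 0 < w i) (hZw : ∀ i, (Z *ᵥ w) i < w i)
    (hx : ∀ i, (Z *ᵥ x) i ≤ x i) (i : Fin d) : 0 ≤ x i := by
  by_contra! hneg
  have : Nonempty (Fin d) := ⟨i⟩
  obtain ⟨k, hk⟩ := Finite.exists_min fun i => x i / w i
  set m := x k / w k with hm
  have hm0 : m < 0 := (hk i).trans_lt (div_neg_of_neg_of_pos hneg (hw i))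
  have hxk : x k = m * w k := by rw [hm, div_mul_cancel₀ _ (hw k).ne']
  have h1 : m * (Z *ᵥ w) k ≤ (Z *ᵥ x) k := by
    simp only [Matrix.mulVec, dotProduct, Finset.mul_sum]
    refine Finset.sum_le_sum fun j _ => ?_
    nlinarith [mul_le_mul_of_nonneg_left ((le_div_iff₀ (hw j)).mp (hk j)) (hZ k j)]
  have h2 := mul_lt_mul_of_neg_left (hZw k) hm0
  linarith [hx k]

/-- Along a path of non-negative matrices `Z t` with `1 - Z t` invertible, the existence of a
positive strictly superharmonic vector persists. -/
theorem exists_superharmonic_of_path {Z : ℝ → Matrix (Fin d) (Fin d) ℝ}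
    (hc : Continuous Z) (hZ : ∀ t ∈ Set.Icc (0 : ℝ) 1, ∀ i j, 0 ≤ Z t i j)
    (hdet : ∀ t ∈ Set.Icc (0 : ℝ) 1, (1 - Z t).det ≠ 0)
    (h0 : ∃ w : Fin d → ℝ, (∀ i, 0 < w i) ∧ ∀ i, (Z 0 *ᵥ w) i < w i) :
    ∃ w : Fin d → ℝ, (∀ i, 0 < w i) ∧ ∀ i, (Z 1 *ᵥ w) i < w i := by
  -- The solution of `x = Z x + 1`: once it is non-negative, it is positive and strictly
  -- superharmonic.
  let x : ℝ → Fin d → ℝ := fun t => (1 - Z t)⁻¹ *ᵥ 1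
  have hx : ∀ t ∈ Set.Icc (0 : ℝ) 1, ∀ i, x t i = (Z t *ᵥ x t) i + 1 := by
    intro t ht i
    have h1 : (1 - Z t) *ᵥ x t = 1 := by
      simp only [x]
      rw [Matrix.mulVec_mulVec, Matrix.mul_nonsing_inv _ (isUnit_iff_ne_zero.mpr (hdet t ht)),
        Matrix.one_mulVec]
    have h2 := congrFun h1 i
    rw [Matrix.sub_mulVec, Matrix.one_mulVec, Pi.sub_apply, Pi.one_apply] at h2
    linarith
  have hxc : ContinuousOn x (Set.Icc 0 1) := by
    have hsub : Continuous fun t => 1 - Z t := continuous_const.sub hc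
    have hinv : ContinuousOn (fun t => (1 - Z t)⁻¹) (Set.Icc 0 1) := by
      simp only [Matrix.inv_def, Ring.inverse_eq_inv']
      exact (hsub.matrix_det.continuousOn.inv₀ hdet).smul hsub.matrix_adjugate.continuousOn
    refine continuousOn_pi.mpr fun i => ?_
    simp only [x, Matrix.mulVec, dotProduct]
    refine continuousOn_finsetSum _ fun j _ => ContinuousOn.mul ?_ continuousOn_const
    exact (continuous_apply_apply i j).comp_continuousOn hinv
  have hnn : ∀ t ∈ Set.Icc (0 : ℝ) 1,
      (∃ w : Fin d → ℝ, (∀ i, 0 < w i) ∧ ∀ i, (Z t *ᵥ w) i < w i) → ∀ i, 0 ≤ x t i := by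
    rintro t ht ⟨w, hw, hZw⟩
    exact nonneg_of_mulVec_le (hZ t ht) hw hZw fun i => by linarith [hx t ht i]
  have hpos : ∀ t ∈ Set.Icc (0 : ℝ) 1, (∀ i, 0 ≤ x t i) →
      (∀ i, 0 < x t i) ∧ ∀ i, (Z t *ᵥ x t) i < x t i := by
    intro t ht h
    refine ⟨fun i => ?_, fun i => by linarith [hx t ht i]⟩
    have : 0 ≤ (Z t *ᵥ x t) i := mulVec_nonneg (hZ t ht) h i
    linarith [hx t ht i]
  -- Continuous induction: `x t` remains strictly superharmonic for `Z s` with `s` near `t`, so the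
  -- minimum principle gives `x s ≥ 0`.
  have hsub : Set.Icc (0 : ℝ) 1 ⊆ {t | ∀ i, 0 ≤ x t i} := by
    refine IsClosed.Icc_subset_of_forall_exists_gt ?_ (hnn 0 (by simp) h0) ?_
    · have := hxc.preimage_isClosed_of_isClosed isClosed_Icc
        (isClosed_Ici (a := (0 : Fin d → ℝ)))
      rwa [Set.inter_comm] at this
    · rintro t ⟨ht, ht01⟩ b hb
      obtain ⟨hp, hlt⟩ := hpos t ⟨ht01.1, ht01.2.le⟩ ht
      have hev : ∀ᶠ s in nhds t, ∀ i, (Z s *ᵥ x t) i < x t i := by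
        refine Filter.eventually_all.mpr fun i => ?_
        have hcont : Continuous fun s => (Z s *ᵥ x t) i :=
          (continuous_apply i).comp (hc.matrix_mulVec continuous_const)
        exact hcont.continuousAt.eventually_lt continuousAt_const (hlt i)
      have hb' : Set.Ioc t (min b 1) ∈ nhdsWithin t (Set.Ioi t) :=
        Ioc_mem_nhdsGT (lt_min hb ht01.2)
      obtain ⟨s, hs, hsb⟩ := ((hev.filter_mono nhdsWithin_le_nhds).and hb').exists
      have hs01 : s ∈ Set.Icc (0 : ℝ) 1 :=
        ⟨ht01.1.trans hsb.1.le, hsb.2.trans (min_le_right _ _)⟩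
      exact ⟨s, hnn s hs01 ⟨x t, hp, hs⟩, hsb.1, hsb.2.trans (min_le_left _ _)⟩
  exact ⟨x 1, hpos 1 (by simp) (hsub (by simp))⟩

/-! ### Frobenius norm identities -/

theorem frobenius_norm_sq (Z : Matrix (Fin d) (Fin d) ℝ) : ‖Z‖ ^ 2 = ∑ i, ∑ j, Z i j ^ 2 := by
  rw [Matrix.frobenius_norm_def, ← Real.sqrt_eq_rpow, Real.sq_sqrt (by positivity)]
  simp

theorem mulVec_dotProduct_self_le (Z : Matrix (Fin d) (Fin d) ℝ) (x : Fin d → ℝ) :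
    (Z *ᵥ x) ⬝ᵥ (Z *ᵥ x) ≤ ‖Z‖ ^ 2 * (x ⬝ᵥ x) := by
  rw [frobenius_norm_sq, Finset.sum_mul]
  refine Finset.sum_le_sum fun i _ => ?_
  have := Finset.sum_mul_sq_le_sq_mul_sq Finset.univ (fun j => Z i j) x
  simpa only [Matrix.mulVec, dotProduct, ← sq] using this

theorem vecMulVec_norm_sq (a b : Fin d → ℝ) : ‖vecMulVec a b‖ ^ 2 = (a ⬝ᵥ a) * (b ⬝ᵥ b) := by
  rw [frobenius_norm_sq, dotProduct, dotProduct, Finset.sum_mul_sum]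
  refine Finset.sum_congr rfl fun i _ => Finset.sum_congr rfl fun j _ => ?_
  rw [vecMulVec_apply]
  ring

/-! ### First-order conditions at a positive local minimum -/

theorem eventually_norm_le_of_tendsto {A X : Matrix (Fin d) (Fin d) ℝ}
    (hX_loc : IsLocalMinOn (fun Y : Matrix (Fin d) (Fin d) ℝ => ‖Y - A‖) (stableNonneg d) X)
    {Y : ℝ → Matrix (Fin d) (Fin d) ℝ}
    (hY : Filter.Tendsto Y (nhdsWithin 0 (Set.Ioi 0)) (nhds X))
    (hf : ∀ᶠ t in nhdsWithin 0 (Set.Ioi 0), Y t ∈ stableNonneg d) :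
    ∀ᶠ t in nhdsWithin 0 (Set.Ioi 0), ‖X - A‖ ^ 2 ≤ ‖Y t - A‖ ^ 2 := by
  have h := (tendsto_nhdsWithin_iff.mpr ⟨hY, hf⟩).eventually hX_loc
  filter_upwards [h] with t ht
  exact pow_le_pow_left₀ (norm_nonneg _) ht 2

/-- First-order necessary condition along a feasible rank-one direction. -/
theorem dotProduct_mulVec_nonpos {A X : Matrix (Fin d) (Fin d) ℝ}
    (hX_loc : IsLocalMinOn (fun Y : Matrix (Fin d) (Fin d) ℝ => ‖Y - A‖) (stableNonneg d) X)
    (a h : Fin d → ℝ)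
    (hf : ∀ᶠ t : ℝ in nhdsWithin 0 (Set.Ioi 0), X + t • vecMulVec a h ∈ stableNonneg d) :
    a ⬝ᵥ ((A - X) *ᵥ h) ≤ 0 := by
  have hcont : Continuous fun t : ℝ => X + t • vecMulVec a h := by fun_prop
  have hlim : Filter.Tendsto (fun t : ℝ => X + t • vecMulVec a h)
      (nhdsWithin 0 (Set.Ioi 0)) (nhds X) := by
    have := hcont.tendsto 0
    rw [zero_smul, add_zero] at this
    exact this.mono_left nhdsWithin_le_nhds
  have hev := eventually_norm_le_of_tendsto hX_loc hlim hf
  have hexp : ∀ t : ℝ, ‖X + t • vecMulVec a h - A‖ ^ 2 =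
      ‖X - A‖ ^ 2 - 2 * t * (a ⬝ᵥ ((A - X) *ᵥ h)) + t ^ 2 * ‖vecMulVec a h‖ ^ 2 := by
    intro t
    simp only [frobenius_norm_sq, dotProduct, Matrix.mulVec, Finset.mul_sum,
      ← Finset.sum_sub_distrib, ← Finset.sum_add_distrib]
    refine Finset.sum_congr rfl fun i _ => Finset.sum_congr rfl fun j _ => ?_
    simp only [Matrix.sub_apply, Matrix.add_apply, Matrix.smul_apply, vecMulVec_apply,
      smul_eq_mul]
    ring
  have hle : ∀ᶠ t : ℝ in nhdsWithin 0 (Set.Ioi 0),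
      2 * (a ⬝ᵥ ((A - X) *ᵥ h)) ≤ t * ‖vecMulVec a h‖ ^ 2 := by
    filter_upwards [hev, self_mem_nhdsWithin] with t ht ht0
    rw [hexp] at ht
    have ht0' : 0 < t := ht0
    refine le_of_mul_le_mul_left ?_ ht0'
    linarith
  have hlim0 : Filter.Tendsto (fun t : ℝ => t * ‖vecMulVec a h‖ ^ 2)
      (nhdsWithin 0 (Set.Ioi 0)) (nhds 0) := by
    have hc : Continuous fun t : ℝ => t * ‖vecMulVec a h‖ ^ 2 := by fun_prop
    have := hc.tendsto 0
    rw [zero_mul] at this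
    exact this.mono_left nhdsWithin_le_nhds
  linarith [ge_of_tendsto hlim0 hle]

/-- A functional that is nonpositive on a closed half-space is a non-negative multiple of the
functional defining it. -/
theorem exists_eq_smul_of_forall_nonpos {q w : Fin d → ℝ} (hw : w ≠ 0)
    (h : ∀ x, x ⬝ᵥ w ≤ 0 → q ⬝ᵥ x ≤ 0) : ∃ c : ℝ, 0 ≤ c ∧ q = c • w := by
  have hww : 0 < w ⬝ᵥ w := lt_of_le_of_ne (Finset.sum_nonneg fun i _ => mul_self_nonneg _)
    (Ne.symm (mt dotProduct_self_eq_zero.mp hw))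
  refine ⟨(q ⬝ᵥ w) / (w ⬝ᵥ w), div_nonneg ?_ hww.le, ?_⟩
  · have := h (-w) (by rw [neg_dotProduct]; linarith)
    rw [dotProduct_neg] at this
    linarith
  · set c := (q ⬝ᵥ w) / (w ⬝ᵥ w) with hc
    -- The component of `q` orthogonal to `w` is itself an admissible test vector, so its squared
    -- length is nonpositive.
    have h0 : (q - c • w) ⬝ᵥ w = 0 := by
      rw [sub_dotProduct, smul_dotProduct, smul_eq_mul, hc, div_mul_cancel₀ _ hww.ne', sub_self]
    have h1 := h _ h0.le
    have h2 : (q - c • w) ⬝ᵥ (q - c • w) ≤ 0 := by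
      conv_lhs => rw [sub_dotProduct, smul_dotProduct, dotProduct_comm w, h0, smul_zero, sub_zero]
      exact h1
    have h3 : (q - c • w) ⬝ᵥ (q - c • w) = 0 :=
      le_antisymm h2 (Finset.sum_nonneg fun i _ => mul_self_nonneg _)
    exact sub_eq_zero.mp (dotProduct_self_eq_zero.mp h3)

theorem eventually_pos {Y : ℝ → Matrix (Fin d) (Fin d) ℝ} {X : Matrix (Fin d) (Fin d) ℝ}
    {l : Filter ℝ} (hX : ∀ i j, 0 < X i j) (hY : Filter.Tendsto Y l (nhds X)) :
    ∀ᶠ t in l, ∀ i j, 0 < Y t i j :=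
  Filter.eventually_all.mpr fun i => Filter.eventually_all.mpr fun j =>
    ((continuous_apply_apply i j).tendsto X |>.comp hY).eventually_const_lt (hX i j)

theorem eventually_pos_add_smul {X : Matrix (Fin d) (Fin d) ℝ} (hX : ∀ i j, 0 < X i j)
    (H : Matrix (Fin d) (Fin d) ℝ) :
    ∀ᶠ t : ℝ in nhdsWithin 0 (Set.Ioi 0), ∀ i j, 0 < (X + t • H) i j := by
  refine eventually_pos hX ?_
  have hcont : Continuous fun t : ℝ => X + t • H := by fun_prop
  have := hcont.tendsto 0
  rw [zero_smul, add_zero] at this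
  exact this.mono_left nhdsWithin_le_nhds

/-- First-order description of a positive local minimum: it differs from `A` by a positive
multiple of the outer product of its left and right Perron eigenvectors. -/
theorem exists_eq_add_vecMulVec {A X : Matrix (Fin d) (Fin d) ℝ} (hd : 0 < d)
    (hA_rho : 1 < rho A) (hX_pos : ∀ i j, 0 < X i j) (hX_feas : X ∈ stableNonneg d)
    (hX_loc : IsLocalMinOn (fun Y : Matrix (Fin d) (Fin d) ℝ => ‖Y - A‖) (stableNonneg d) X) :
    ∃ b v : Fin d → ℝ, (∀ i, 0 < b i) ∧ (∀ i, 0 < v i) ∧ v ⬝ᵥ v = 1 ∧ X *ᵥ v = v ∧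
      b ᵥ* X = b ∧ A = X + vecMulVec b v := by
  have hAX : A ≠ X := by
    rintro rfl
    exact absurd hX_feas.2 (not_le.mpr hA_rho)
  obtain ⟨l, w, y, hw, hy, hXw, hyX⟩ := exists_pos_eigenvector_pair hd hX_pos
  have hw0 : w ≠ 0 := fun h => (hw ⟨0, hd⟩).ne' (congrFun h _)
  have hy0 : y ≠ 0 := fun h => (hy ⟨0, hd⟩).ne' (congrFun h _)
  have hl1 : l ≤ 1 := (abs_le.mp (abs_le_one_of_mulVec_eq hX_feas.2 hw0 hXw)).2
  have hmul : ∀ (t : ℝ) (a h : Fin d → ℝ) (i : Fin d),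
      ((X + t • vecMulVec a h) *ᵥ w) i = l * w i + t * (a i * (h ⬝ᵥ w)) := by
    intro t a h i
    rw [Matrix.add_mulVec, hXw, Matrix.smul_mulVec, Matrix.vecMulVec_mulVec]
    simp [mul_comm]
  have hvmul : ∀ (t : ℝ) (a h : Fin d → ℝ) (i : Fin d),
      (y ᵥ* (X + t • vecMulVec a h)) i = l * y i + t * ((y ⬝ᵥ a) * h i) := by
    intro t a h i
    rw [Matrix.vecMul_add, hyX, Matrix.vecMul_smul, Matrix.vecMul_vecMulVec]
    simp
  -- If `l < 1`, `w` stays superharmonic under every small perturbation; moving each row straight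
  -- towards `A` then forces `X = A`.
  have hl : l = 1 := by
    by_contra hne
    have hlt : l < 1 := lt_of_le_of_ne hl1 hne
    refine hAX (sub_eq_zero.mp ?_)
    ext i j
    have hrow : (fun j => (A - X) i j) = 0 := by
      have h1 := dotProduct_mulVec_nonpos hX_loc (Pi.single i 1) (fun j => (A - X) i j) ?_
      · rw [single_dotProduct, one_mul] at h1
        exact dotProduct_self_eq_zero.mp
          (le_antisymm h1 (Finset.sum_nonneg fun i _ => mul_self_nonneg _))
      · have hev : ∀ᶠ t : ℝ in nhdsWithin 0 (Set.Ioi 0), ∀ k,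
            l * w k + t * ((Pi.single i 1 : Fin d → ℝ) k * ((fun j => (A - X) i j) ⬝ᵥ w)) < w k := by
          refine Filter.eventually_all.mpr fun k => ?_
          have hc : Continuous fun t : ℝ => l * w k +
            t * ((Pi.single i 1 : Fin d → ℝ) k * ((fun j => (A - X) i j) ⬝ᵥ w)) := by fun_prop
          refine Filter.Eventually.filter_mono nhdsWithin_le_nhds
            (hc.continuousAt.eventually_lt continuousAt_const ?_)
          rw [zero_mul, add_zero]
          exact mul_lt_of_lt_one_left (hw k) hlt
        filter_upwards [hev, eventually_pos_add_smul hX_pos _] with t ht htp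
        exact mem_stableNonneg_of_mulVec_le (fun i j => (htp i j).le) hw
          fun k => (hmul _ _ _ _).trans_le (ht k).le
    exact congrFun hrow j
  subst hl
  -- Adding a positive multiple of `h` to row `i` keeps `w` superharmonic whenever `h · w ≤ 0`.
  have hrow : ∀ i, ∃ p : ℝ, 0 ≤ p ∧ (fun j => (A - X) i j) = p • w := by
    refine fun i => exists_eq_smul_of_forall_nonpos hw0 fun h hh => ?_
    have h1 := dotProduct_mulVec_nonpos hX_loc (Pi.single i 1) h ?_
    · rwa [single_dotProduct, one_mul] at h1
    · filter_upwards [eventually_pos_add_smul hX_pos _, self_mem_nhdsWithin] with t htp ht0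
      refine mem_stableNonneg_of_mulVec_le (fun i j => (htp i j).le) hw fun k => ?_
      rw [hmul, one_mul]
      have h2 : (0 : ℝ) ≤ (Pi.single i 1 : Fin d → ℝ) k := by
        by_cases hk : k = i <;> simp [hk]
      have h3 : t * ((Pi.single i 1 : Fin d → ℝ) k * (h ⬝ᵥ w)) ≤ 0 :=
        mul_nonpos_of_nonneg_of_nonpos (le_of_lt ht0) (mul_nonpos_of_nonneg_of_nonpos h2 hh)
      linarith
  have hcol : ∀ j, ∃ q : ℝ, 0 ≤ q ∧ (fun i => (A - X) i j) = q • y := by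
    refine fun j => exists_eq_smul_of_forall_nonpos hy0 fun h hh => ?_
    have h1 := dotProduct_mulVec_nonpos hX_loc h (Pi.single j 1) ?_
    · rw [Matrix.mulVec_single_one, dotProduct_comm] at h1
      exact h1
    · filter_upwards [eventually_pos_add_smul hX_pos _, self_mem_nhdsWithin] with t htp ht0
      refine mem_stableNonneg_of_vecMul_le (fun i j => (htp i j).le) hy fun k => ?_
      rw [hvmul, one_mul, dotProduct_comm]
      have h2 : (0 : ℝ) ≤ (Pi.single j 1 : Fin d → ℝ) k := by
        by_cases hk : k = j <;> simp [hk]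
      have h3 : t * ((h ⬝ᵥ y) * (Pi.single j 1 : Fin d → ℝ) k) ≤ 0 :=
        mul_nonpos_of_nonneg_of_nonpos (le_of_lt ht0) (mul_nonpos_of_nonpos_of_nonneg hh h2)
      linarith
  choose p hp hpw using hrow
  choose q hq hqy using hcol
  let j₀ : Fin d := ⟨0, hd⟩
  set c := q j₀ / w j₀ with hc
  have hpc : ∀ i, p i = c * y i := by
    intro i
    have h1 : (A - X) i j₀ = p i * w j₀ := congrFun (hpw i) j₀
    have h2 : (A - X) i j₀ = q j₀ * y i := congrFun (hqy j₀) i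
    rw [hc, div_mul_eq_mul_div, ← h2, h1, mul_div_cancel_right₀ _ (hw j₀).ne']
  have hD : ∀ i j, (A - X) i j = c * y i * w j := fun i j => by
    rw [← hpc]; exact congrFun (hpw i) j
  have hcpos : 0 < c := by
    refine lt_of_le_of_ne (div_nonneg (hq _) (hw _).le) fun h0 => hAX (sub_eq_zero.mp ?_)
    ext i j
    rw [hD, ← h0]
    simp
  have hww : 0 < w ⬝ᵥ w :=
    Finset.sum_pos (fun i _ => mul_pos (hw i) (hw i)) ⟨j₀, Finset.mem_univ _⟩
  set n := √(w ⬝ᵥ w) with hn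
  have hnpos : 0 < n := Real.sqrt_pos.mpr hww
  have hnn : n * n = w ⬝ᵥ w := Real.mul_self_sqrt hww.le
  -- The factor `n = |w|` is moved from `w` to `y` in `A - X = c y wᵀ`, which makes `v` a unit
  -- vector.
  refine ⟨(c * n) • y, n⁻¹ • w, fun i => mul_pos (mul_pos hcpos hnpos) (hy i),
    fun i => mul_pos (inv_pos.mpr hnpos) (hw i), ?_, ?_, ?_, ?_⟩
  · rw [smul_dotProduct, dotProduct_smul, ← hnn, smul_eq_mul, smul_eq_mul]
    field_simp
  · rw [Matrix.mulVec_smul, hXw, one_smul]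
  · rw [Matrix.smul_vecMul, hyX, one_smul]
  · ext i j
    have := hD i j
    rw [Matrix.sub_apply] at this
    rw [Matrix.add_apply, vecMulVec_apply, Pi.smul_apply, Pi.smul_apply, smul_eq_mul, smul_eq_mul]
    field_simp
    linarith

/-! ### Local minimality as a Rayleigh quotient inequality -/

/-- At a positive local minimum `A - b vᵀ`, the distance to `A` is the smallest singular value
of `A - 1`. -/
theorem mul_dotProduct_le_of_isLocalMinOn {A X : Matrix (Fin d) (Fin d) ℝ}
    (hX_pos : ∀ i j, 0 < X i j)
    (hX_loc : IsLocalMinOn (fun Y : Matrix (Fin d) (Fin d) ℝ => ‖Y - A‖) (stableNonneg d) X)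
    {b v : Fin d → ℝ} (hv : ∀ i, 0 < v i) (hvv : v ⬝ᵥ v = 1)
    (hAv : (A - 1) *ᵥ v = b) (hbA : b ᵥ* (A - 1) = (b ⬝ᵥ b) • v)
    (hA : A = X + vecMulVec b v) (z : Fin d → ℝ) :
    (b ⬝ᵥ b) * (z ⬝ᵥ z) ≤ ((A - 1) *ᵥ z) ⬝ᵥ ((A - 1) *ᵥ z) := by
  let x : ℝ → Fin d → ℝ := fun s => v + s • z
  -- `Y s` is the matrix nearest to `A` that fixes `x s`, at squared distance `|(A - 1) x|² / |x|²`.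
  let Y : ℝ → Matrix (Fin d) (Fin d) ℝ := fun s =>
    A - (x s ⬝ᵥ x s)⁻¹ • vecMulVec ((A - 1) *ᵥ x s) (x s)
  have hx0 : x 0 = v := by simp [x]
  have hxc : Continuous x := by fun_prop
  have hxxc : Continuous fun s => x s ⬝ᵥ x s := by fun_prop
  have hY0 : Y 0 = X := by
    simp only [Y, hx0, hvv, hAv, inv_one, one_smul]
    rw [hA, add_sub_cancel_right]
  have hYlim : Filter.Tendsto Y (nhdsWithin 0 (Set.Ioi 0)) (nhds X) := by
    rw [← hY0]
    refine Filter.Tendsto.mono_left (ContinuousAt.tendsto ?_) nhdsWithin_le_nhds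
    refine continuousAt_const.sub (ContinuousAt.smul (hxxc.continuousAt.inv₀ ?_) ?_)
    · rw [hx0, hvv]; exact one_ne_zero
    · exact ((continuous_const.matrix_mulVec hxc).matrix_vecMulVec hxc).continuousAt
  have hxpos : ∀ᶠ s in nhdsWithin 0 (Set.Ioi 0), ∀ i, 0 < x s i := by
    refine Filter.eventually_all.mpr fun i => ?_
    have : Filter.Tendsto (fun s => x s i) (nhdsWithin 0 (Set.Ioi 0)) (nhds (x 0 i)) :=
      (((continuous_apply i).comp hxc).tendsto 0).mono_left nhdsWithin_le_nhds
    exact this.eventually_const_lt (by rw [hx0]; exact hv i)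
  have hxx : ∀ᶠ s in nhdsWithin 0 (Set.Ioi 0), 0 < x s ⬝ᵥ x s := by
    have : Filter.Tendsto (fun s => x s ⬝ᵥ x s) (nhdsWithin 0 (Set.Ioi 0)) (nhds (x 0 ⬝ᵥ x 0)) :=
      (hxxc.tendsto 0).mono_left nhdsWithin_le_nhds
    exact this.eventually_const_lt (by rw [hx0, hvv]; exact one_pos)
  have hfeas : ∀ᶠ s in nhdsWithin 0 (Set.Ioi 0), Y s ∈ stableNonneg d := by
    filter_upwards [eventually_pos hX_pos hYlim, hxpos, hxx] with s hs hxs hxxs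
    refine mem_stableNonneg_of_mulVec_le (fun i j => (hs i j).le) hxs fun i => le_of_eq ?_
    have : Y s *ᵥ x s = x s := by
      simp only [Y]
      rw [Matrix.sub_mulVec, Matrix.smul_mulVec, Matrix.vecMulVec_mulVec, op_smul_eq_smul,
        smul_smul, inv_mul_cancel₀ hxxs.ne', one_smul, Matrix.sub_mulVec, Matrix.one_mulVec,
        sub_sub_cancel]
    rw [this]
  -- One `s > 0` suffices: after clearing the denominator, the terms of order 0 and 1 in `s` cancel
  -- exactly, leaving `s²` times the claim.
  obtain ⟨s, hs, hxxs, hs0⟩ := ((eventually_norm_le_of_tendsto hX_loc hYlim hfeas).and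
    (hxx.and self_mem_nhdsWithin)).exists
  have hs0' : 0 < s := hs0
  have h1 : ‖X - A‖ ^ 2 = b ⬝ᵥ b := by
    rw [hA, norm_sub_rev, add_sub_cancel_left, vecMulVec_norm_sq, hvv, mul_one]
  have h2 : ‖Y s - A‖ ^ 2 =
      (x s ⬝ᵥ x s)⁻¹ * (((A - 1) *ᵥ x s) ⬝ᵥ ((A - 1) *ᵥ x s)) := by
    simp only [Y]
    rw [norm_sub_rev, sub_sub_cancel, ← Matrix.smul_vecMulVec, vecMulVec_norm_sq,
      smul_dotProduct, dotProduct_smul, smul_eq_mul, smul_eq_mul]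
    field_simp
  rw [h1, h2, inv_mul_eq_div, le_div_iff₀ hxxs] at hs
  have h3 : x s ⬝ᵥ x s = 1 + 2 * s * (v ⬝ᵥ z) + s ^ 2 * (z ⬝ᵥ z) := by
    simp only [x, add_dotProduct, dotProduct_add, smul_dotProduct, dotProduct_smul, smul_eq_mul,
      hvv, dotProduct_comm z v]
    ring
  have h4 : b ⬝ᵥ ((A - 1) *ᵥ z) = (b ⬝ᵥ b) * (v ⬝ᵥ z) := by
    rw [Matrix.dotProduct_mulVec, hbA, smul_dotProduct, smul_eq_mul]
  have h5 : ((A - 1) *ᵥ x s) ⬝ᵥ ((A - 1) *ᵥ x s) = b ⬝ᵥ b + 2 * s * ((b ⬝ᵥ b) * (v ⬝ᵥ z)) +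
      s ^ 2 * (((A - 1) *ᵥ z) ⬝ᵥ ((A - 1) *ᵥ z)) := by
    simp only [x, Matrix.mulVec_add, Matrix.mulVec_smul, hAv, add_dotProduct, dotProduct_add,
      smul_dotProduct, dotProduct_smul, smul_eq_mul, dotProduct_comm _ b, h4]
    ring
  rw [h3, h5] at hs
  refine le_of_mul_le_mul_left ?_ (pow_pos hs0' 2)
  linarith

/-! ### Global lower bound on the distance -/

/-- If `ρ(A) > 1`, no feasible matrix is closer to `A` than the smallest singular value
of `A - 1`. -/
theorem le_norm_sub_sq {A Y : Matrix (Fin d) (Fin d) ℝ} (hA : ∀ i j, 0 ≤ A i j)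
    (hA_rho : 1 < rho A) {μ : ℝ}
    (hμ : ∀ z : Fin d → ℝ, μ * (z ⬝ᵥ z) ≤ ((A - 1) *ᵥ z) ⬝ᵥ ((A - 1) *ᵥ z))
    (hY : Y ∈ stableNonneg d) : μ ≤ ‖Y - A‖ ^ 2 := by
  by_contra! hlt
  -- A fixed vector `z` at time `t` satisfies `(A - 1) z = (1 - t) (A - Y) z`, too short when `‖A -
  -- Y‖² < μ`.
  have hdet : ∀ t ∈ Set.Icc (0 : ℝ) 1, (1 - (Y + t • (A - Y))).det ≠ 0 := by
    rintro t ⟨ht0, ht1⟩ h0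
    obtain ⟨z, hz0, hz⟩ := Matrix.exists_mulVec_eq_zero_iff.mpr h0
    have hzz : 0 < z ⬝ᵥ z := lt_of_le_of_ne (Finset.sum_nonneg fun i _ => mul_self_nonneg _)
      (Ne.symm (mt dotProduct_self_eq_zero.mp hz0))
    have hmat : A - 1 = (1 - t) • (A - Y) - (1 - (Y + t • (A - Y))) := by
      rw [sub_smul, one_smul]; abel
    have hAz : (A - 1) *ᵥ z = (1 - t) • ((A - Y) *ᵥ z) := by
      rw [hmat, Matrix.sub_mulVec, hz, sub_zero, Matrix.smul_mulVec]
    have h1 := hμ z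
    rw [hAz, smul_dotProduct, dotProduct_smul, smul_eq_mul, smul_eq_mul] at h1
    have h2 := mulVec_dotProduct_self_le (A - Y) z
    rw [norm_sub_rev] at h2
    have h3 : 0 ≤ ((A - Y) *ᵥ z) ⬝ᵥ ((A - Y) *ᵥ z) :=
      Finset.sum_nonneg fun i _ => mul_self_nonneg _
    have h4 := mul_lt_mul_of_pos_right hlt hzz
    nlinarith [mul_nonneg (mul_nonneg ht0 (by linarith : (0 : ℝ) ≤ 2 - t)) h3]
  -- The path `s Y` starts at 0; a singular `1 - s Y` needs the eigenvalue `1/s ≥ 1` of `Y`, so `s =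
  -- 1`, which `hdet` at 0 excludes.
  have hYpath : ∃ w : Fin d → ℝ, (∀ i, 0 < w i) ∧ ∀ i, (Y *ᵥ w) i < w i := by
    have := exists_superharmonic_of_path (Z := fun s => s • Y) (by fun_prop)
      (fun t ht i j => mul_nonneg ht.1 (hY.1 i j)) ?_ ⟨1, fun _ => one_pos, fun i => by simp⟩
    · simpa using this
    · rintro t ⟨ht0, ht1⟩ h0
      obtain ⟨z, hz0, hz⟩ := Matrix.exists_mulVec_eq_zero_iff.mpr h0
      rw [Matrix.sub_mulVec, Matrix.one_mulVec, Matrix.smul_mulVec, sub_eq_zero] at hz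
      have ht : t ≠ 0 := by
        rintro rfl
        exact hz0 (by rw [hz, zero_smul])
      have htpos : 0 < t := lt_of_le_of_ne ht0 ht.symm
      have hYz : Y *ᵥ z = t⁻¹ • z := by
        conv_rhs => rw [hz]
        rw [smul_smul, inv_mul_cancel₀ ht, one_smul]
      have h1 := (abs_le.mp (abs_le_one_of_mulVec_eq hY.2 hz0 hYz)).2
      have h2 : t = 1 := le_antisymm ht1 ((inv_le_one₀ htpos).mp h1)
      subst h2
      refine hdet 0 (by simp) (Matrix.exists_mulVec_eq_zero_iff.mp ⟨z, hz0, ?_⟩)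
      rw [zero_smul, add_zero, Matrix.sub_mulVec, Matrix.one_mulVec, hYz, inv_one, one_smul,
        sub_self]
  have hApath := exists_superharmonic_of_path (Z := fun t => Y + t • (A - Y)) (by fun_prop)
    (fun t ht i j => ?_) hdet (by simpa using hYpath)
  · obtain ⟨w, hw, hAw⟩ := hApath
    have : A ∈ stableNonneg d := mem_stableNonneg_of_mulVec_le hA hw fun i => by
      have := (hAw i).le
      rwa [one_smul, add_sub_cancel] at this
    exact absurd this.2 (not_le.mpr hA_rho)
  · simp only [Matrix.add_apply, Matrix.smul_apply, Matrix.sub_apply, smul_eq_mul]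
    nlinarith [mul_nonneg ht.1 (hA i j), mul_nonneg (sub_nonneg.mpr ht.2) (hY.1 i j)]

end ClosestStable

/-! ### The theorem -/

theorem theorem4 {d : ℕ} (A X : Matrix (Fin d) (Fin d) ℝ)
    (hA : ∀ i j, 0 ≤ A i j) (hA_rho : 1 < ClosestStable.rho A)
    (hX_pos : ∀ i j, 0 < X i j)
    (hX_feas : X ∈ ClosestStable.stableNonneg d)
    (hX_loc : IsLocalMinOn (fun Y : Matrix (Fin d) (Fin d) ℝ => ‖Y - A‖)
      (ClosestStable.stableNonneg d) X) :
    IsMinOn (fun Y : Matrix (Fin d) (Fin d) ℝ => ‖Y - A‖) (ClosestStable.stableNonneg d) X ∧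
    ∃ (μ : ℝ) (v : Fin d → ℝ),
      (∀ i, 0 < v i) ∧
      X = A - (A - 1) * vecMulVec v v ∧
      ClosestStable.FormulaHypotheses A μ v ∧
      X = ClosestStable.matX A (-√μ) v := by
  have hd : 0 < d := by
    by_contra! h
    obtain rfl : d = 0 := by omega
    exact absurd (ClosestStable.mem_stableNonneg_of_mulVec_le hA (w := 1)
      (fun i => i.elim0) (fun i => i.elim0)).2 (not_le.mpr hA_rho)
  obtain ⟨b, v, hb, hv, hvv, hXv, hbX, hAX⟩ :=
    ClosestStable.exists_eq_add_vecMulVec hd hA_rho hX_pos hX_feas hX_loc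
  have hAv : (A - 1) *ᵥ v = b := by
    rw [hAX, Matrix.sub_mulVec, Matrix.add_mulVec, hXv, Matrix.vecMulVec_mulVec, hvv,
      Matrix.one_mulVec]
    simp
  have hbA : b ᵥ* (A - 1) = (b ⬝ᵥ b) • v := by
    rw [hAX, Matrix.vecMul_sub, Matrix.vecMul_add, hbX, Matrix.vecMul_vecMulVec,
      Matrix.vecMul_one, add_sub_cancel_left]
  have hmin := ClosestStable.mul_dotProduct_le_of_isLocalMinOn hX_pos hX_loc hv hvv hAv hbA hAX
  have hbb : 0 < b ⬝ᵥ b :=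
    Finset.sum_pos (fun i _ => mul_pos (hb i) (hb i)) ⟨⟨0, hd⟩, Finset.mem_univ _⟩
  have hXA : ‖X - A‖ ^ 2 = b ⬝ᵥ b := by
    rw [hAX, norm_sub_rev, add_sub_cancel_left, ClosestStable.vecMulVec_norm_sq, hvv, mul_one]
  have hAv' : (1 - A) *ᵥ v = -b := by
    rw [← neg_sub, Matrix.neg_mulVec, hAv]
  have hsq : 0 < √(b ⬝ᵥ b) := Real.sqrt_pos.mpr hbb
  -- Here `μ = |b|²`; since `(1 - A) v = -b`, the negative `r` makes `u = b / |b|` non-negative.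
  have hmatX : X = ClosestStable.matX A (-√(b ⬝ᵥ b)) v := by
    rw [ClosestStable.matX, ClosestStable.vecU, hAv', Matrix.smul_vecMulVec, smul_smul,
      mul_one_div_cancel (neg_ne_zero.mpr hsq.ne'), one_smul, Matrix.neg_vecMulVec, hAX,
      add_neg_cancel_right]
  have hv0 : v ≠ 0 := fun h => (hv ⟨0, hd⟩).ne' (congrFun h _)
  have heig : Module.End.HasEigenvector (Matrix.toLin' (ClosestStable.matM A)) (b ⬝ᵥ b) v := by
    refine Module.End.hasEigenvector_iff.mpr ⟨Module.End.mem_eigenspace_iff.mpr ?_, hv0⟩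
    rw [Matrix.toLin'_apply, ClosestStable.matM, ← Matrix.mulVec_mulVec, hAv', ← hbA,
      ← Matrix.transpose_one, ← Matrix.transpose_sub, Matrix.mulVec_transpose,
      Matrix.transpose_one, ← neg_sub, Matrix.neg_vecMul_neg]
  refine ⟨fun Y hY => ?_, b ⬝ᵥ b, v, hv, ?_, ⟨hbb.ne', ⟨?_, ?_⟩, heig, hvv, fun i => (hv i).le,
    fun i => ?_, fun i j => ?_⟩, hmatX⟩
  · exact le_of_sq_le_sq (hXA.trans_le (ClosestStable.le_norm_sub_sq hA hA_rho hmin hY))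
      (norm_nonneg _)
  · rw [Matrix.mul_vecMulVec, hAv]
    exact eq_sub_of_add_eq hAX.symm
  · exact Module.End.hasEigenvalue_of_hasEigenvector heig
  · rintro t ht
    obtain ⟨z, hz⟩ := Module.End.HasEigenvalue.exists_hasEigenvector ht
    have hzz : 0 < z ⬝ᵥ z := lt_of_le_of_ne (Finset.sum_nonneg fun i _ => mul_self_nonneg _)
      (Ne.symm (mt dotProduct_self_eq_zero.mp hz.2))
    have h1 : ClosestStable.matM A *ᵥ z = t • z := hz.apply_eq_smul
    have h2 : t * (z ⬝ᵥ z) = ((A - 1) *ᵥ z) ⬝ᵥ ((A - 1) *ᵥ z) := by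
      rw [← smul_eq_mul, ← dotProduct_smul, ← h1, ClosestStable.matM, ← Matrix.transpose_one,
        ← Matrix.transpose_sub, Matrix.transpose_one, ← Matrix.mulVec_mulVec,
        Matrix.dotProduct_mulVec, Matrix.vecMul_transpose, ← neg_sub, Matrix.neg_mulVec,
        neg_dotProduct_neg]
    exact le_of_mul_le_mul_right ((hmin z).trans_eq h2.symm) hzz
  · rw [ClosestStable.vecU, hAv']
    simp only [Pi.smul_apply, Pi.neg_apply, smul_eq_mul]
    rw [one_div, inv_neg, neg_mul_neg]
    exact mul_nonneg (inv_nonneg.mpr hsq.le) (hb i).le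
  · rw [← hmatX]
    exact (hX_pos i j).le
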